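/- Let $N,K,T$ be positive integers with $N>2K$, let $\sigma>0$, and put $\varepsilon=\frac{\sigma}{2}\sqrt{\frac{NK}{2T}}$. For a $K$-element subset $a^*$ of the arms $[N]=\{1,\dots,N\}$ consider the following environment: in round $t=1,\dots,T$ arm $i$ has reward $$X'_{i,t}=\tfrac12+\varepsilon\,\mathbf 1_{\{i\in a^*\}}+Z_t ,$$ where $Z_1,\dots,Z_T$ are independent $\mathcal N(0,\sigma^2)$ random variables, each shared by all arms. In each round the player chooses a $K$-element subset $a_t\subset[N]$ and observes only the joint reward $r_{a_t}(t)=\sum_{i\in a_t}X'_{i,t}$. A deterministic player chooses $a_t$ as a fixed (measurable) function of the actions $a_1,\dots,a_{t-1}$ and of the rewards $r_{a_1}(1),\dots,r_{a_{t-1}}(t-1)$, without knowledge of $a^*$. Its expected regret against $a^*$ is $R(a^*)=\mathbb E\bigl[\sum_{t=1}^T\bigl(r_{a^*}(t)-r_{a_t}(t)\bigr)\bigr]$. Then every deterministic player suffers expected regret $\Omega(\sigma K\sqrt{KNT})$. More precisely, when $a^*$ is drawn uniformly at random from the $K$-element subsets of $[N]$, $$\frac{1}{\binom NK}\sum_{a^*\subset[N],\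 |a^*|=K}R(a^*)\ \ge\ \frac{\sigma K}{8}\sqrt{\frac{NKT}{2}},$$ and hence for every deterministic player there is a $K$-element subset $a^*$ with $R(a^*)\ge\frac{\sigma K}{8}\sqrt{\frac{NKT}{2}}$. -/

import Mathlib

open MeasureTheory ProbabilityTheory

namespace TopKBandit

/-- An action: a set of exactly `K` of the `N` arms. -/
def Action (N K : ℕ) : Type := {a : Finset (Fin N) // a.card = K}

instance (N K : ℕ) : Fintype (Action N K) :=
  inferInstanceAs (Fintype {a : Finset (Fin N) // a.card = K})

/-- The finite set of actions carries the discrete σ-algebra. -/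
instance (N K : ℕ) : MeasurableSpace (Action N K) := ⊤

/-- A deterministic player under full-bandit feedback: the action of a round is a (measurable)
function of the actions played and the joint rewards observed in the earlier rounds.
Rounds are numbered `0, 1, 2, …`. -/
structure Player (N K : ℕ) where
  act : (t : ℕ) → (Fin t → Action N K × ℝ) → Action N K
  measurable_act : ∀ t, Measurable (act t)

/-- The joint reward function `f(d) = ∑ₖ d(k)`. -/
def jointReward {K : ℕ} (d : Fin K → ℝ) : ℝ := ∑ k, d k

/-- The vector of the individual rewards `x i` of the arms of an action, in increasing order of
the arms. -/
def rewardVector {N K : ℕ} (x : Fin N → ℝ) (a : Action N K) : Fin K → ℝ :=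
  fun k => x (a.1.orderEmbOfFin a.2 k)

section Environment

variable {N K : ℕ} (ε : ℝ) (best : Action N K)

/-- The reward `1/2 + ε · 1{i ∈ a*} + z` of arm `i`, where `a* = best` and `z` is the noise of the
round, shared by all arms. -/
noncomputable def armReward (z : ℝ) (i : Fin N) : ℝ :=
  1 / 2 + ε * (if i ∈ best.1 then 1 else 0) + z

/-- The joint reward of an action in a round with noise `z`. -/
noncomputable def reward (z : ℝ) (a : Action N K) : ℝ :=
  jointReward (rewardVector (armReward ε best z) a)

/-- The actions played and the joint rewards observed in the first `t` rounds, when the noise of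
round `s` is `z s`. -/
noncomputable def history (π : Player N K) (z : ℕ → ℝ) : (t : ℕ) → Fin t → Action N K × ℝ
  | 0 => Fin.elim0
  | t + 1 =>
    Fin.snoc (α := fun _ => Action N K × ℝ) (history π z t)
      (π.act t (history π z t), reward ε best (z t) (π.act t (history π z t)))

/-- The action played in round `t`. -/
noncomputable def played (π : Player N K) (z : ℕ → ℝ) (t : ℕ) : Action N K :=
  π.act t (history ε best π z t)

/-- The realized regret over `T` rounds against the action `best`. -/
noncomputable def realizedRegret (π : Player N K) (T : ℕ) (z : ℕ → ℝ) : ℝ :=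
  ∑ t ∈ Finset.range T, (reward ε best (z t) best - reward ε best (z t) (played ε best π z t))

/-- The expected regret over `T` rounds, when the noise is the process `Z`. -/
noncomputable def expectedRegret {Ω : Type*} [MeasurableSpace Ω] (P : Measure Ω)
    (Z : ℕ → Ω → ℝ) (π : Player N K) (T : ℕ) : ℝ :=
  ∫ ω, realizedRegret ε best π T (fun t => Z t ω) ∂P

end Environment

end TopKBandit

/-! The regret against `a` is `ε` times `K T` minus the expected number of plays of the arms of `a`,
so it suffices that this number is on average over `a` at most `3/4 · K T`
(`sum_expectedCount_best_le`).

The environment `a` is compared, for each `i ∈ a`, with the one where only the `K - 1` arms of `b =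
a \ {i}` are advantaged. The noise is shared, so an action earns its mean plus `K z`; raising arm
`i` by `ε` is therefore the same as shifting the noise by `ε / K` in the rounds where `i` is played.
This shift is predictable, and its relative entropy is `(ε / K)² / (2 σ²)` times the expected number
of plays of `i` under `b`. Girsanov, Hoeffding's lemma and Jensen turn this into
`integral_le_integral_add_entropy`, whence `expectedTotal_insert_le`.

With `M = N - K + 1`, it is applied to the plays of `i` weighted by `M` plus the plays of `b`.
Summed over `i ∈ a`, this statistic gives `N` times the plays of `a`; summed over `i ∉ b`, it gives
`M` times all plays, that is `M K T`. Double counting the pairs `(a, i)` and `(b, i)` then bounds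
the average by `K T (K / N + 1/4)`, and `K / N < 1/2`. -/

namespace TopKBandit

open scoped ENNReal NNReal

/-! ### Finite Gaussian noise and translation of one Gaussian. -/

/-- The law of the first `T` terms of an i.i.d. sequence of centered Gaussians of variance `v`. -/
noncomputable def noiseLaw (v : ℝ≥0) (T : ℕ) : Measure (Fin T → ℝ) :=
  Measure.pi fun _ => gaussianReal 0 v

instance (v : ℝ≥0) (T : ℕ) : IsProbabilityMeasure (noiseLaw v T) := by
  unfold noiseLaw; infer_instance

/-- Extension of a finite sequence by zero. -/
def extendZero {T : ℕ} (w : Fin T → ℝ) (t : ℕ) : ℝ := if h : t < T then w ⟨t, h⟩ else 0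

lemma extendZero_val {T : ℕ} (w : Fin T → ℝ) (t : Fin T) : extendZero w t = w t := by
  simp [extendZero]

lemma extendZero_snoc {T : ℕ} (w : Fin T → ℝ) (x : ℝ) {t : ℕ} (ht : t < T) :
    extendZero (Fin.snoc (α := fun _ => ℝ) w x) t = extendZero w t := by
  simp [extendZero, ht, Nat.lt_succ_of_lt ht, Fin.snoc]

@[fun_prop]
lemma measurable_extendZero {T : ℕ} : Measurable (extendZero (T := T)) := by
  refine measurable_pi_lambda _ fun t => ?_
  by_cases h : t < T
  · simpa [extendZero, h] using measurable_pi_apply (⟨t, h⟩ : Fin T)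
  · simp [extendZero, h]

/-- Splits off the noise of the last round, for inductions on the number of rounds. -/
lemma measurePreserving_snoc (v : ℝ≥0) (T : ℕ) :
    MeasurePreserving (fun p : ℝ × (Fin T → ℝ) => Fin.snoc (α := fun _ => ℝ) p.2 p.1)
      ((gaussianReal 0 v).prod (noiseLaw v T)) (noiseLaw v (T + 1)) := by
  have h := (measurePreserving_piFinSuccAbove (fun _ : Fin (T + 1) => gaussianReal 0 v)
    (Fin.last T)).symm
  convert! h using 1
  ext p : 1
  exact (Fin.insertNth_last' p.1 p.2).symm

/-- Change of measure for a translated centered Gaussian. -/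
lemma lintegral_gaussianReal_sub {v : ℝ≥0} (hv : v ≠ 0) (s : ℝ) {h : ℝ → ℝ≥0∞}
    (hh : Measurable h) :
    ∫⁻ x, h (x - s) * ENNReal.ofReal (Real.exp (s * x / v - s ^ 2 / (2 * v))) ∂gaussianReal 0 v
      = ∫⁻ x, h x ∂gaussianReal 0 v := by
  rw [gaussianReal_of_var_ne_zero _ hv]
  rw [lintegral_withDensity_eq_lintegral_mul _ (measurable_gaussianPDF _ _) (by fun_prop),
    lintegral_withDensity_eq_lintegral_mul _ (measurable_gaussianPDF _ _) hh,
    ← lintegral_sub_right_eq_self (fun x => (gaussianPDF 0 v * h) x) s]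
  refine lintegral_congr fun x => ?_
  have hv' : (v : ℝ) ≠ 0 := by exact_mod_cast hv
  have : gaussianPDF 0 v x * ENNReal.ofReal (Real.exp (s * x / v - s ^ 2 / (2 * v)))
      = gaussianPDF 0 v (x - s) := by
    simp only [gaussianPDF, gaussianPDFReal]
    rw [← ENNReal.ofReal_mul (by positivity), mul_assoc, ← Real.exp_add]
    congr 3
    field_simp
    ring
  simp only [Pi.mul_apply]
  rw [← this]
  ring

/-! ### Predictable shifts, Girsanov's formula and the entropy inequality. -/

/-- `s t w` depends only on the terms `w i` with `i < t`. -/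
def Predictable {α : Type*} (s : ℕ → (ℕ → ℝ) → α) : Prop :=
  ∀ t w w', (∀ i < t, w i = w' i) → s t w = s t w'

/-- The sequence obtained by subtracting the predictable process `s`. -/
def unshift (s : ℕ → (ℕ → ℝ) → ℝ) {T : ℕ} (w : Fin T → ℝ) : Fin T → ℝ :=
  fun t => w t - s t (extendZero w)

/-- The logarithm of the Girsanov density attached to the predictable process `s`. -/
noncomputable def logDensity (v : ℝ≥0) (s : ℕ → (ℕ → ℝ) → ℝ) {T : ℕ} (w : Fin T → ℝ) : ℝ :=
  ∑ t : Fin T, (s t (extendZero w) * w t / v - s t (extendZero w) ^ 2 / (2 * v))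

section Girsanov

variable {s : ℕ → (ℕ → ℝ) → ℝ}

lemma Predictable.apply_extendZero_snoc {α : Type*} {s : ℕ → (ℕ → ℝ) → α} (hp : Predictable s)
    {T t : ℕ} (ht : t ≤ T) (w : Fin T → ℝ) (x : ℝ) :
    s t (extendZero (Fin.snoc (α := fun _ => ℝ) w x)) = s t (extendZero w) :=
  hp _ _ _ fun _ hi => extendZero_snoc w x (hi.trans_le ht)

lemma unshift_snoc (hp : Predictable s) {T : ℕ} (w : Fin T → ℝ) (x : ℝ) :
    unshift s (Fin.snoc (α := fun _ => ℝ) w x)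
      = Fin.snoc (α := fun _ => ℝ) (unshift s w) (x - s T (extendZero w)) := by
  ext t
  refine Fin.lastCases ?_ (fun t => ?_) t
  · simp [unshift, hp.apply_extendZero_snoc le_rfl]
  · simp [unshift, hp.apply_extendZero_snoc t.2.le]

lemma logDensity_snoc (v : ℝ≥0) (hp : Predictable s) {T : ℕ} (w : Fin T → ℝ) (x : ℝ) :
    logDensity v s (Fin.snoc (α := fun _ => ℝ) w x)
      = logDensity v s w
        + (s T (extendZero w) * x / v - s T (extendZero w) ^ 2 / (2 * v)) := by
  unfold logDensity
  rw [Fin.sum_univ_castSucc]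
  congr 1
  · refine Finset.sum_congr rfl fun t _ => ?_
    simp [hp.apply_extendZero_snoc t.2.le]
  · simp [hp.apply_extendZero_snoc le_rfl]

lemma measurable_unshift (hs : ∀ t, Measurable (s t)) {T : ℕ} :
    Measurable (unshift s (T := T)) := by
  refine measurable_pi_lambda _ fun t => ?_
  have := hs t
  unfold unshift
  fun_prop

lemma measurable_logDensity (v : ℝ≥0) (hs : ∀ t, Measurable (s t)) {T : ℕ} :
    Measurable (logDensity v s (T := T)) := by
  unfold logDensity
  fun_prop

/-- Girsanov's formula for Gaussian noise in discrete time. -/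
theorem lintegral_unshift_mul_density {v : ℝ≥0} (hv : v ≠ 0) (hs : ∀ t, Measurable (s t))
    (hp : Predictable s) (T : ℕ) {h : (Fin T → ℝ) → ℝ≥0∞} (hh : Measurable h) :
    ∫⁻ w, h (unshift s w) * ENNReal.ofReal (Real.exp (logDensity v s w)) ∂noiseLaw v T
      = ∫⁻ w, h w ∂noiseLaw v T := by
  induction T with
  | zero =>
    refine lintegral_congr fun w => ?_
    simp [logDensity, Subsingleton.elim (unshift s w) w]
  | succ T ih =>
    have hm := measurePreserving_snoc v T
    have hu := measurable_unshift hs (T := T)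
    have hu' := measurable_unshift hs (T := T + 1)
    have hl' := measurable_logDensity v hs (T := T + 1)
    have hsnoc := hm.measurable
    have hh2 := hh.comp hsnoc
    rw [← hm.lintegral_comp (by fun_prop), ← hm.lintegral_comp hh,
      lintegral_prod_symm' _ (by fun_prop), lintegral_prod_symm' _ (by fun_prop)]
    -- The last variable is integrated out first; the induction hypothesis applies to the resulting
    -- function of the earlier ones.
    rw [← ih (h := fun w => ∫⁻ x, h (Fin.snoc (α := fun _ => ℝ) w x) ∂gaussianReal 0 v)
      (Measurable.lintegral_prod_left' hh2)]
    refine lintegral_congr fun w => ?_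
    have h1 : Measurable fun x : ℝ => h (Fin.snoc (α := fun _ => ℝ) (unshift s w) x) :=
      hh2.comp (measurable_id.prodMk measurable_const)
    -- For fixed `w` the last shift is a constant, so the one-variable formula applies.
    rw [← lintegral_gaussianReal_sub hv (s T (extendZero w)) h1,
      ← lintegral_mul_const _ (by fun_prop)]
    refine lintegral_congr fun x => ?_
    rw [unshift_snoc hp, logDensity_snoc v hp, Real.exp_add,
      ENNReal.ofReal_mul (Real.exp_nonneg _)]
    ring

/-- A martingale transform: each factor `s t` is determined before the independent centered noise `w
t`, so every product has mean zero. -/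
lemma integral_predictable_mul (v : ℝ≥0) (hs : ∀ t, Measurable (s t)) (hp : Predictable s)
    {C : ℝ} (hC : ∀ t w, |s t w| ≤ C) (T : ℕ) :
    Integrable (fun w => ∑ t : Fin T, s t (extendZero w) * w t) (noiseLaw v T) ∧
      ∫ w, ∑ t : Fin T, s t (extendZero w) * w t ∂noiseLaw v T = 0 := by
  induction T with
  | zero => simp
  | succ T ih =>
    have hm := measurePreserving_snoc v T
    have hmeas : AEStronglyMeasurable
        (fun w : Fin (T + 1) → ℝ => ∑ t : Fin (T + 1), s t (extendZero w) * w t)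
        (noiseLaw v (T + 1)) :=
      (by fun_prop : Measurable _).aestronglyMeasurable
    have hid : Integrable (fun x : ℝ => x) (gaussianReal 0 v) :=
      (memLp_id_gaussianReal 1).integrable le_rfl
    have hsT : Integrable (fun w : Fin T → ℝ => s T (extendZero w)) (noiseLaw v T) :=
      Integrable.of_bound (by fun_prop : Measurable _).aestronglyMeasurable C
        (Filter.Eventually.of_forall fun w => hC _ _)
    have heq : (fun p : ℝ × (Fin T → ℝ) => ∑ t : Fin (T + 1),
          s t (extendZero (Fin.snoc (α := fun _ => ℝ) p.2 p.1))
            * (Fin.snoc (α := fun _ => ℝ) p.2 p.1 : Fin (T + 1) → ℝ) t)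
        = fun p => (∑ t : Fin T, s t (extendZero p.2) * p.2 t) + p.1 * s T (extendZero p.2) := by
      ext p
      rw [Fin.sum_univ_castSucc]
      congr 1
      · refine Finset.sum_congr rfl fun t _ => ?_
        simp [hp.apply_extendZero_snoc t.2.le]
      · simp [hp.apply_extendZero_snoc le_rfl, mul_comm]
    have i1 := ih.1.comp_snd (gaussianReal 0 v)
    have i2 := hid.mul_prod hsT
    constructor
    · rw [← hm.integrable_comp hmeas]
      exact (i1.add i2).congr (.of_forall fun p => (congrFun heq p).symm)
    · rw [← hm.map_eq, integral_map hm.measurable.aemeasurable (by rwa [hm.map_eq]), heq,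
        integral_add i1 i2,
        integral_prod_mul (fun x : ℝ => x) (fun w : Fin T → ℝ => s T (extendZero w)), integral_id_gaussianReal,
        integral_fun_snd (fun w : Fin T → ℝ => ∑ t : Fin T, s t (extendZero w) * w t), ih.2]
      simp

/-- Comparison of the expectations of a `[0, 1]`-valued statistic before and after a predictable
shift of Gaussian noise: their difference is at most the relative entropy plus `1 / 8`. -/
theorem integral_le_integral_add_entropy {v : ℝ≥0} (hv : v ≠ 0) (hs : ∀ t, Measurable (s t))
    (hp : Predictable s) {C : ℝ} (hC : ∀ t w, |s t w| ≤ C) {T : ℕ} {f g : (Fin T → ℝ) → ℝ}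
    (hf : Measurable f) (hg : Measurable g) (hf01 : ∀ w, f w ∈ Set.Icc 0 1)
    (hg01 : ∀ w, g w ∈ Set.Icc 0 1) (hfg : ∀ w, g (unshift s w) = f w) :
    ∫ w, g w ∂noiseLaw v T ≤ ∫ w, f w ∂noiseLaw v T
      + (∫ w, ∑ t : Fin T, s t (extendZero w) ^ 2 ∂noiseLaw v T) / (2 * v) + 1 / 8 := by
  set μ := noiseLaw v T
  set m := ∫ w, g w ∂μ with hm
  have hfi : Integrable f μ := Integrable.of_mem_Icc 0 1 hf.aemeasurable (.of_forall hf01)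
  -- Hoeffding's lemma: a `[0, 1]`-valued variable is sub-Gaussian with parameter `1/4`, so the
  -- centered moment generating function at `-1` is at most `exp (1/8)`.
  have hgs := hasSubgaussianMGF_of_mem_Icc (μ := μ) hg.aemeasurable (.of_forall hg01)
  have hmgf := hgs.mgf_le (-1)
  have hint := hgs.integrable_exp_mul (-1)
  rw [← hm] at hmgf hint
  have hL := measurable_logDensity v hs (T := T)
  have hgir := lintegral_unshift_mul_density hv hs hp T
    (h := fun w => ENNReal.ofReal (Real.exp (-1 * (g w - m)))) (by fun_prop)
  have hgir' : ∫⁻ w, ENNReal.ofReal (Real.exp (m - f w + logDensity v s w)) ∂μ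
      = ∫⁻ w, ENNReal.ofReal (Real.exp (-1 * (g w - m))) ∂μ := by
    rw [← hgir]
    refine lintegral_congr fun w => ?_
    rw [hfg, ← ENNReal.ofReal_mul (Real.exp_nonneg _), ← Real.exp_add]
    congr 2
    ring
  have hfin : ∫⁻ w, ENNReal.ofReal (Real.exp (m - f w + logDensity v s w)) ∂μ ≠ ∞ := by
    rw [hgir']
    exact hint.lintegral_lt_top.ne
  have hYi : Integrable (fun w => Real.exp (m - f w + logDensity v s w)) μ := by
    refine ⟨by fun_prop, ?_⟩
    rw [hasFiniteIntegral_iff_ofReal (.of_forall fun _ => Real.exp_nonneg _)]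
    exact hfin.lt_top
  have hYe : ∫ w, Real.exp (m - f w + logDensity v s w) ∂μ ≤ Real.exp (1 / 8) := by
    rw [integral_eq_lintegral_of_nonneg_ae (.of_forall fun _ => Real.exp_nonneg _) (by fun_prop),
      hgir', ← integral_eq_lintegral_of_nonneg_ae (.of_forall fun _ => Real.exp_nonneg _)
        (by fun_prop)]
    refine hmgf.trans (Real.exp_le_exp.2 (le_of_eq ?_))
    norm_num
  obtain ⟨i1, e1⟩ := integral_predictable_mul v hs hp hC T
  have i2 : Integrable (fun w => ∑ t : Fin T, s t (extendZero w) ^ 2) μ := by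
    refine integrable_finsetSum _ fun t _ => ?_
    refine Integrable.of_bound (by fun_prop : Measurable _).aestronglyMeasurable (C ^ 2) (.of_forall fun w => ?_)
    rw [Real.norm_eq_abs, abs_pow]
    exact pow_le_pow_left₀ (abs_nonneg _) (hC _ _) 2
  have hlog : logDensity v s (T := T) = fun w => (∑ t : Fin T, s t (extendZero w) * w t) / v
      - (∑ t : Fin T, s t (extendZero w) ^ 2) / (2 * v) := by
    ext w
    rw [logDensity, Finset.sum_sub_distrib, Finset.sum_div, Finset.sum_div]
  have iL : Integrable (logDensity v s (T := T)) μ := by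
    rw [hlog]
    exact (i1.div_const _).sub (i2.div_const _)
  -- The martingale part vanishes; minus the relative entropy remains.
  have eL : ∫ w, logDensity v s w ∂μ
      = -((∫ w, ∑ t : Fin T, s t (extendZero w) ^ 2 ∂μ) / (2 * v)) := by
    rw [hlog, integral_sub (i1.div_const _) (i2.div_const _), integral_div, integral_div, e1]
    simp [μ]
  have hmf : Integrable (fun w => m - f w) μ := (integrable_const m).sub hfi
  have iY : Integrable (fun w => m - f w + logDensity v s w) μ := hmf.add iL
  -- Jensen's inequality in the form of the tangent to `exp` at `1/8`, the point where the upper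
  -- bound `exp (1/8)` is attained.
  have hlin : ∫ w, Real.exp (1 / 8) * (m - f w + logDensity v s w + (1 - 1 / 8)) ∂μ
      ≤ ∫ w, Real.exp (m - f w + logDensity v s w) ∂μ := by
    refine integral_mono ((iY.add (integrable_const _)).const_mul _) hYi fun w => ?_
    have := Real.add_one_le_exp (m - f w + logDensity v s w - 1 / 8)
    calc _ ≤ Real.exp (1 / 8) * Real.exp (m - f w + logDensity v s w - 1 / 8) := by
          gcongr; linarith
      _ = _ := by rw [← Real.exp_add]; congr 1; ring
  rw [integral_const_mul, integral_add iY (integrable_const _), integral_add hmf iL,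
    integral_sub (integrable_const m) hfi, eL] at hlin
  simp only [integral_const, probReal_univ, one_smul] at hlin
  have := le_of_mul_le_mul_left ((hlin.trans hYe).trans_eq (mul_one _).symm) (Real.exp_pos _)
  linarith

end Girsanov

/-! ### The player as a function of the mean rewards and the noise. -/

variable {N K : ℕ}

/-- The history of a player when action `a` under noise `z` yields the reward `m a + K z`. -/
noncomputable def historyOfMean (m : Action N K → ℝ) (π : Player N K) (z : ℕ → ℝ) :
    (t : ℕ) → Fin t → Action N K × ℝ
  | 0 => Fin.elim0
  | t + 1 =>
    Fin.snoc (α := fun _ => Action N K × ℝ) (historyOfMean m π z t)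
      (π.act t (historyOfMean m π z t), m (π.act t (historyOfMean m π z t)) + K * z t)

/-- The action of round `t` when action `a` under noise `z` yields the reward `m a + K z`. -/
noncomputable def choice (m : Action N K → ℝ) (π : Player N K) (t : ℕ) (z : ℕ → ℝ) :
    Action N K :=
  π.act t (historyOfMean m π z t)

/-- The mean reward of an action when the arms in `S` have an advantage `ε`. -/
noncomputable def meanReward (ε : ℝ) (S : Finset (Fin N)) (a : Action N K) : ℝ :=
  K / 2 + ε * ∑ i ∈ S, if i ∈ a.1 then 1 else 0

lemma sum_orderEmbOfFin (a : Action N K) (f : Fin N → ℝ) :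
    ∑ k, f (a.1.orderEmbOfFin a.2 k) = ∑ i ∈ a.1, f i := by
  have h := Finset.sum_map Finset.univ (a.1.orderEmbOfFin a.2).toEmbedding f
  rw [Finset.map_orderEmbOfFin_univ] at h
  exact h.symm

lemma sum_mem_indicator (a : Action N K) : ∑ i, (if i ∈ a.1 then (1 : ℝ) else 0) = K := by
  rw [Finset.sum_ite_mem]
  simp [a.2]

/-- Each of the `K` arms played carries the same `z`. Through `meanReward`, any set of advantaged
arms is allowed, including the reference sets of size `K - 1`. -/
lemma reward_eq_meanReward (ε : ℝ) (best : Action N K) (z : ℝ) (a : Action N K) :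
    reward ε best z a = meanReward ε best.1 a + K * z := by
  rw [reward, jointReward]
  simp only [rewardVector]
  rw [sum_orderEmbOfFin a (armReward ε best z)]
  simp only [armReward, Finset.sum_add_distrib, ← Finset.mul_sum, meanReward, Finset.sum_ite_mem,
    Finset.sum_const, a.2, nsmul_eq_mul, Finset.inter_comm best.1]
  ring

lemma meanReward_insert (ε : ℝ) {S : Finset (Fin N)} {i : Fin N} (hi : i ∉ S) (a : Action N K) :
    meanReward ε (insert i S) a = meanReward ε S a + ε * (if i ∈ a.1 then 1 else 0) := by
  rw [meanReward, meanReward, Finset.sum_insert hi]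
  ring

lemma history_eq_historyOfMean (ε : ℝ) (best : Action N K) (π : Player N K) (z : ℕ → ℝ) (t : ℕ) :
    history ε best π z t = historyOfMean (meanReward ε best.1) π z t := by
  induction t with
  | zero => rfl
  | succ t ih => rw [history, historyOfMean, ih, reward_eq_meanReward]

lemma played_eq_choice (ε : ℝ) (best : Action N K) (π : Player N K) (z : ℕ → ℝ) (t : ℕ) :
    played ε best π z t = choice (meanReward ε best.1) π t z := by
  rw [played, choice, history_eq_historyOfMean]

/-- Two environments that produce the same observations produce the same actions. -/
lemma choice_congr {m m' : Action N K → ℝ} {π : Player N K} {z z' : ℕ → ℝ} {t : ℕ}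
    (h : ∀ i < t, m (choice m π i z) + K * z i = m' (choice m π i z) + K * z' i) :
    choice m π t z = choice m' π t z' := by
  suffices historyOfMean m π z t = historyOfMean m' π z' t by rw [choice, choice, this]
  induction t with
  | zero => rfl
  | succ t ih =>
    have h' := h t t.lt_succ_self
    rw [choice] at h'
    rw [historyOfMean, historyOfMean, ← ih fun i hi => h i (hi.trans t.lt_succ_self), h']

lemma predictable_choice (m : Action N K → ℝ) (π : Player N K) : Predictable (choice m π) :=
  fun _ _ _ h => choice_congr fun i hi => by rw [h i hi]

lemma measurable_choice (m : Action N K → ℝ) (π : Player N K) (t : ℕ) :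
    Measurable (choice m π t) := by
  suffices Measurable fun z => historyOfMean m π z t from (π.measurable_act t).comp this
  induction t with
  | zero => exact measurable_const
  | succ t ih =>
    have hc : Measurable fun z => π.act t (historyOfMean m π z t) := (π.measurable_act t).comp ih
    have hm : Measurable m := measurable_from_top
    refine measurable_pi_lambda _ fun i => ?_
    refine Fin.lastCases ?_ (fun i => ?_) i
    · simp only [historyOfMean, Fin.snoc_last]
      exact hc.prodMk ((hm.comp hc).add (by fun_prop))
    · simp only [historyOfMean, Fin.snoc_castSucc]
      exact (measurable_pi_apply i).comp ih

/-! ### Expected play counts and the effect of one more advantaged arm. -/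

/-- The expectation of `∑ t < T, F a_t` under Gaussian noise of variance `v`, when the arms in `S`
have an advantage `ε`. -/
noncomputable def expectedTotal (v : ℝ≥0) (T : ℕ) (ε : ℝ) (π : Player N K) (S : Finset (Fin N))
    (F : Action N K → ℝ) : ℝ :=
  ∫ w, ∑ t : Fin T, F (choice (meanReward ε S) π t (extendZero w)) ∂noiseLaw v T

section Total

variable (v : ℝ≥0) (T : ℕ) (ε : ℝ) (π : Player N K) (S : Finset (Fin N))

lemma measurable_total (F : Action N K → ℝ) :
    Measurable fun w : Fin T → ℝ =>
      ∑ t : Fin T, F (choice (meanReward ε S) π t (extendZero w)) := by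
  refine Finset.measurable_fun_sum _ fun t _ => ?_
  exact (measurable_from_top (f := F)).comp ((measurable_choice _ π t).comp measurable_extendZero)

lemma integrable_total (F : Action N K → ℝ) :
    Integrable (fun w : Fin T → ℝ =>
      ∑ t : Fin T, F (choice (meanReward ε S) π t (extendZero w))) (noiseLaw v T) := by
  refine Integrable.of_bound (measurable_total T ε π S F).aestronglyMeasurable
    (∑ _t : Fin T, ∑ a, ‖F a‖) (.of_forall fun w => ?_)
  refine (norm_sum_le _ _).trans (Finset.sum_le_sum fun t _ => ?_)
  exact Finset.single_le_sum (f := fun a => ‖F a‖) (fun a _ => norm_nonneg _) (Finset.mem_univ _)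

lemma expectedTotal_const (c : ℝ) : expectedTotal v T ε π S (fun _ => c) = T * c := by
  simp [expectedTotal]

lemma expectedTotal_sum {ι : Type*} (A : Finset ι) (F : ι → Action N K → ℝ) :
    expectedTotal v T ε π S (fun a => ∑ i ∈ A, F i a)
      = ∑ i ∈ A, expectedTotal v T ε π S (F i) := by
  simp only [expectedTotal]
  rw [← integral_finsetSum _ fun i _ => integrable_total v T ε π S (F i)]
  congr with w
  exact Finset.sum_comm

lemma expectedTotal_add (F G : Action N K → ℝ) :
    expectedTotal v T ε π S (fun a => F a + G a)
      = expectedTotal v T ε π S F + expectedTotal v T ε π S G := by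
  simp only [expectedTotal]
  rw [← integral_add (integrable_total v T ε π S F) (integrable_total v T ε π S G)]
  simp only [Finset.sum_add_distrib]

lemma expectedTotal_const_mul (c : ℝ) (F : Action N K → ℝ) :
    expectedTotal v T ε π S (fun a => c * F a) = c * expectedTotal v T ε π S F := by
  simp only [expectedTotal, ← Finset.mul_sum, integral_const_mul]

lemma expectedTotal_nonneg {F : Action N K → ℝ} (hF : ∀ a, 0 ≤ F a) :
    0 ≤ expectedTotal v T ε π S F :=
  integral_nonneg fun _ => Finset.sum_nonneg fun _ _ => hF _

/-- The expected number of times that arm `i` is played. -/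
noncomputable def expectedCount (i : Fin N) : ℝ :=
  expectedTotal v T ε π S fun a => if i ∈ a.1 then 1 else 0

lemma expectedCount_nonneg (i : Fin N) : 0 ≤ expectedCount v T ε π S i :=
  expectedTotal_nonneg v T ε π S fun _ => by positivity

lemma sum_expectedCount : ∑ i, expectedCount v T ε π S i = T * K := by
  simp only [expectedCount]
  rw [← expectedTotal_sum]
  simp only [sum_mem_indicator, expectedTotal_const]

variable {v T S}

/-- Giving the advantage `ε` to one more arm changes expectations of bounded statistics little. -/
lemma expectedTotal_insert_le (hv : v ≠ 0) (hT : 1 ≤ T) (hK : 1 ≤ K) {i : Fin N} (hi : i ∉ S)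
    {B : ℝ} (hB : 0 < B) {F : Action N K → ℝ} (hF : ∀ a, F a ∈ Set.Icc 0 B) :
    expectedTotal v T ε π (insert i S) F ≤ expectedTotal v T ε π S F
      + B * T * ((ε / K) ^ 2 / (2 * v) * expectedCount v T ε π S i + 1 / 8) := by
  have hK' : (K : ℝ) ≠ 0 := by positivity
  have hBT : 0 < B * T := by positivity
  set J : Action N K → ℝ := fun a => if i ∈ a.1 then 1 else 0 with hJ
  have hJ01 : ∀ a, J a = 0 ∨ J a = 1 := fun a => by simp only [hJ]; split_ifs <;> simp
  -- Multiplied by `K`, this shift is exactly the extra reward `ε` earned when `i` is played.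
  set s : ℕ → (ℕ → ℝ) → ℝ := fun t w => ε / K * J (choice (meanReward ε S) π t w) with hs
  have hsm : ∀ t, Measurable (s t) := fun t =>
    ((measurable_from_top (f := J)).comp (measurable_choice _ π t)).const_mul _
  have hp : Predictable s := fun t w w' h => by
    simp only [hs, predictable_choice (meanReward ε S) π t w w' h]
  have hC : ∀ t w, |s t w| ≤ |ε / K| := fun t w => by
    simp only [hs, abs_mul]
    rcases hJ01 (choice (meanReward ε S) π t w) with h | h <;> simp [h]
  have h01 : ∀ S' (w : Fin T → ℝ), (∑ t : Fin T, F (choice (meanReward ε S') π t (extendZero w)))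
      / (B * T) ∈ Set.Icc 0 1 := fun S' w => by
    refine ⟨div_nonneg (Finset.sum_nonneg fun t _ => (hF _).1) hBT.le, ?_⟩
    rw [div_le_one hBT]
    calc _ ≤ ∑ t : Fin T, B := Finset.sum_le_sum fun t _ => (hF _).2
      _ = B * T := by simp [mul_comm]
  -- The extra mean and the removed noise cancel, so both environments show the player the same
  -- observations.
  have hfg : ∀ w : Fin T → ℝ,
      (∑ t : Fin T, F (choice (meanReward ε (insert i S)) π t (extendZero (unshift s w)))) / (B * T)
      = (∑ t : Fin T, F (choice (meanReward ε S) π t (extendZero w))) / (B * T) := fun w => by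
    congr 1
    refine Finset.sum_congr rfl fun t _ => ?_
    rw [← choice_congr (z := extendZero w) (m := meanReward ε S)]
    intro j hj
    have hjT := hj.trans t.2
    have h1 := extendZero_val (unshift s w) ⟨j, hjT⟩
    have h2 := extendZero_val w ⟨j, hjT⟩
    simp only at h1 h2
    rw [h1, unshift, meanReward_insert ε hi, ← h2]
    simp only [hs, hJ]
    field_simp
    ring
  have key := integral_le_integral_add_entropy hv hsm hp hC
    ((measurable_total T ε π S F).div_const (B * T))
    ((measurable_total T ε π (insert i S) F).div_const (B * T)) (h01 S) (h01 _) hfg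
  have hsq : ∫ w, ∑ t : Fin T, s t (extendZero w) ^ 2 ∂noiseLaw v T
      = (ε / K) ^ 2 * expectedCount v T ε π S i := by
    rw [expectedCount, ← expectedTotal_const_mul, expectedTotal]
    congr with w
    refine Finset.sum_congr rfl fun t _ => ?_
    -- The indicator `J` equals its square, so the entropy counts the plays of `i`.
    simp only [hs, mul_pow]
    rcases hJ01 (choice (meanReward ε S) π t (extendZero w)) with h | h <;>
      simp only [hJ] at h ⊢ <;> rw [h] <;> norm_num
  rw [integral_div, integral_div, hsq, div_add' _ _ _ hBT.ne', div_add' _ _ _ hBT.ne',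
    div_le_div_iff_of_pos_right hBT] at key
  refine key.trans_eq ?_
  simp only [expectedTotal]
  ring

end Total

/-! ### Averaging over the best subset. -/

/-- Double counting of the pairs of a `k`-element set and a point outside of it. -/
lemma sum_powersetCard_sum_erase {α : Type*} [Fintype α] [DecidableEq α] (k : ℕ)
    (G : Finset α → α → ℝ) :
    ∑ a ∈ Finset.powersetCard (k + 1) Finset.univ, ∑ i ∈ a, G (a.erase i) i
      = ∑ b ∈ Finset.powersetCard k Finset.univ, ∑ i ∈ bᶜ, G b i := by
  rw [Finset.sum_sigma', Finset.sum_sigma']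
  refine Finset.sum_bij' (fun p _ => ⟨p.1.erase p.2, p.2⟩) (fun p _ => ⟨insert p.2 p.1, p.2⟩)
    ?_ ?_ ?_ ?_ ?_
  · rintro ⟨a, i⟩ h
    simp only [Finset.mem_sigma, Finset.mem_powersetCard_univ] at h ⊢
    simp [Finset.card_erase_of_mem h.2, h.1]
  · rintro ⟨b, i⟩ h
    simp only [Finset.mem_sigma, Finset.mem_powersetCard_univ, Finset.mem_compl] at h ⊢
    simp [Finset.card_insert_of_notMem h.2, h.1]
  · rintro ⟨a, i⟩ h
    simp only [Finset.mem_sigma] at h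
    simp [Finset.insert_erase h.2]
  · rintro ⟨b, i⟩ h
    simp only [Finset.mem_sigma, Finset.mem_compl] at h
    simp [Finset.erase_insert h.2]
  · rintro ⟨a, i⟩ _
    rfl

section Counts

variable {N K T : ℕ} {v : ℝ≥0} {ε : ℝ}

/-- The expected number of plays of the arms of a set `a`, in the environment where `a` is best,
is on average over `a` at most `3 / 4` of the total number of plays. -/
theorem sum_expectedCount_best_le (hv : v ≠ 0) (hK : 1 ≤ K) (hN : 2 * K < N) (hT : 1 ≤ T)
    (hε : ε ^ 2 * (8 * T) = v * (N * K)) (π : Player N K) :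
    ∑ a ∈ Finset.powersetCard K Finset.univ, ∑ i ∈ a, expectedCount v T ε π a i
      ≤ 3 / 4 * (K * T) * N.choose K := by
  obtain ⟨k, rfl⟩ : ∃ k, K = k + 1 := ⟨K - 1, by omega⟩
  set n := expectedCount v T ε π with hn
  set c : ℝ := (ε / (k + 1 : ℕ)) ^ 2 / (2 * v) with hc
  have hv0 : (v : ℝ) ≠ 0 := by exact_mod_cast hv
  have hv' : (0 : ℝ) < v := lt_of_le_of_ne v.2 hv0.symm
  have hT' : (0 : ℝ) < T := by exact_mod_cast hT
  -- `M` is the number of arms outside a set of `k = K - 1` arms; `N > 2K` gives `N ≤ 2 M`.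
  obtain ⟨M, rfl⟩ : ∃ M, N = M + k := ⟨N - k, by omega⟩
  have hM : ((M + k : ℕ) : ℝ) ≤ 2 * M := by exact_mod_cast (by omega : M + k ≤ 2 * M)
  have hM0 : (0 : ℝ) < M := by exact_mod_cast (by omega : 0 < M)
  have hc0 : 0 ≤ c := by positivity
  -- This is where the choice of `ε` enters: the entropy summed over all arms is `N / 16 ≤ M / 8`.
  have hcT : c * (T * (k + 1 : ℕ)) = (M + k : ℕ) / 16 := by
    have hk : ((k + 1 : ℕ) : ℝ) ≠ 0 := by positivity
    rw [hc]
    field_simp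
    linear_combination 2 * hε
  have hpair : ∀ a ∈ Finset.powersetCard (k + 1) (Finset.univ : Finset (Fin (M + k))), ∀ i ∈ a,
      M * n a i + ∑ j ∈ a.erase i, n a j
        ≤ M * n (a.erase i) i + ∑ j ∈ a.erase i, n (a.erase i) j
          + (M + k : ℕ) * T * (c * n (a.erase i) i + 1 / 8) := by
    intro a ha i hi
    rw [Finset.mem_powersetCard_univ] at ha
    have h := expectedTotal_insert_le (v := v) (T := T) (S := a.erase i) (i := i) ε π hv hT hK
      (Finset.notMem_erase i a) (B := (M + k : ℕ)) (by push_cast; positivity)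
      -- At most `M + k = N` per round. The weight `M` balances the fact that each `j ∈ b` is
      -- counted once for each of the `M` arms outside `b`.
      (F := fun x => M * (if i ∈ x.1 then 1 else 0)
        + ∑ j ∈ a.erase i, if j ∈ x.1 then 1 else 0) (fun x => by
        have h1 : ∑ j ∈ a.erase i, (if j ∈ x.1 then (1 : ℝ) else 0) ≤ k := by
          calc _ ≤ ∑ j ∈ a.erase i, (1 : ℝ) :=
                Finset.sum_le_sum fun j _ => by split_ifs <;> norm_num
            _ = k := by simp [Finset.card_erase_of_mem hi, ha]
        refine ⟨by positivity, ?_⟩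
        push_cast
        refine add_le_add ?_ h1
        split_ifs <;> simp)
    rw [Finset.insert_erase hi] at h
    simpa only [hn, hc, expectedCount, expectedTotal_add, expectedTotal_const_mul,
      expectedTotal_sum] using h
  have hleft : ∀ a ∈ Finset.powersetCard (k + 1) (Finset.univ : Finset (Fin (M + k))),
      ∑ i ∈ a, (M * n a i + ∑ j ∈ a.erase i, n a j) = (M + k : ℕ) * ∑ i ∈ a, n a i := by
    intro a ha
    rw [Finset.mem_powersetCard_univ] at ha
    have : ∀ i ∈ a, M * n a i + ∑ j ∈ a.erase i, n a j
        = (M - 1) * n a i + ∑ j ∈ a, n a j := fun i hi => by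
      rw [← Finset.add_sum_erase a _ hi]
      ring
    rw [Finset.sum_congr rfl this, Finset.sum_add_distrib, ← Finset.mul_sum, Finset.sum_const, ha]
    simp only [nsmul_eq_mul]
    push_cast
    ring
  have hright : ∀ b ∈ Finset.powersetCard k (Finset.univ : Finset (Fin (M + k))),
      ∑ i ∈ bᶜ, (M * n b i + ∑ j ∈ b, n b j + (M + k : ℕ) * T * (c * n b i + 1 / 8))
        ≤ M * T * ((k + 1 : ℕ) + (M + k : ℕ) / 4) := by
    intro b hb
    rw [Finset.mem_powersetCard_univ] at hb
    have hcard : (bᶜ.card : ℝ) = M := by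
      rw [Finset.card_compl, Fintype.card_fin, hb, Nat.add_sub_cancel]
    have hsum : ∑ i ∈ b, n b i + ∑ i ∈ bᶜ, n b i = T * (k + 1 : ℕ) := by
      rw [Finset.sum_add_sum_compl, sum_expectedCount]
    have hle : ∑ i ∈ bᶜ, n b i ≤ T * (k + 1 : ℕ) := by
      rw [← hsum]
      exact le_add_of_nonneg_left (Finset.sum_nonneg fun i _ => expectedCount_nonneg v T ε π b i)
    have h1 : c * ∑ i ∈ bᶜ, n b i ≤ M / 8 := by
      have := mul_le_mul_of_nonneg_left hle hc0
      linarith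
    simp only [Finset.sum_add_distrib, ← Finset.mul_sum, Finset.sum_const, nsmul_eq_mul, hcard]
    calc _ = M * (∑ i ∈ b, n b i + ∑ i ∈ bᶜ, n b i)
          + (M + k : ℕ) * T * (c * ∑ i ∈ bᶜ, n b i + M * (1 / 8)) := by ring
      _ ≤ M * (T * (k + 1 : ℕ)) + (M + k : ℕ) * T * (M / 8 + M * (1 / 8)) := by
          rw [hsum]; gcongr
      _ = _ := by ring
  have htot : (M + k : ℕ) * ∑ a ∈ Finset.powersetCard (k + 1) Finset.univ, ∑ i ∈ a, n a i
      ≤ (M + k).choose k * (M * T * ((k + 1 : ℕ) + (M + k : ℕ) / 4)) := by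
    calc _ = ∑ a ∈ Finset.powersetCard (k + 1) Finset.univ,
          ∑ i ∈ a, (M * n a i + ∑ j ∈ a.erase i, n a j) := by
          rw [Finset.mul_sum]
          exact Finset.sum_congr rfl fun a ha => (hleft a ha).symm
      _ ≤ _ := Finset.sum_le_sum fun a ha => Finset.sum_le_sum (hpair a ha)
      _ = _ := sum_powersetCard_sum_erase k fun b i => M * n b i + ∑ j ∈ b, n b j
          + (M + k : ℕ) * T * (c * n b i + 1 / 8)
      _ ≤ _ := Finset.sum_le_sum hright
      _ = _ := by simp [Finset.card_powersetCard]
  -- Both sides count the pairs of a `K`-set and one of its points.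
  have hchoose : ((M + k).choose (k + 1) : ℝ) * (k + 1 : ℕ) = (M + k).choose k * M := by
    have := Nat.choose_succ_right_eq (M + k) k
    rw [Nat.add_sub_cancel] at this
    exact_mod_cast this
  have hN' : (0 : ℝ) < (M + k : ℕ) := by push_cast; positivity
  have h2K : 2 * ((k + 1 : ℕ) : ℝ) ≤ (M + k : ℕ) := by exact_mod_cast hN.le
  refine le_of_mul_le_mul_left (htot.trans ?_) hN'
  calc (M + k).choose k * (M * T * ((k + 1 : ℕ) + (M + k : ℕ) / 4) : ℝ)
      = (M + k).choose (k + 1) * (k + 1 : ℕ) * T * ((k + 1 : ℕ) + (M + k : ℕ) / 4) := by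
        rw [hchoose]; ring
    _ ≤ (M + k).choose (k + 1) * (k + 1 : ℕ) * T * (3 / 4 * (M + k : ℕ)) := by
        gcongr; linarith
    _ = _ := by ring

end Counts

/-! ### From play counts to the regret. -/

section Regret

variable {N K : ℕ} (ε : ℝ) (best : Action N K) (π : Player N K)

/-- The shared noise of a round cancels in the difference of two rewards, so noise enters only
through the actions, and these depend on finitely many terms. -/
lemma realizedRegret_eq (T : ℕ) (z : ℕ → ℝ) :
    realizedRegret ε best π T z
      = ∑ t : Fin T, (fun a : Action N K => ε * (K - ∑ i ∈ best.1, if i ∈ a.1 then 1 else 0))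
          (choice (meanReward ε best.1) π t (extendZero fun t : Fin T => z t)) := by
  rw [realizedRegret, Finset.sum_range]
  refine Finset.sum_congr rfl fun t _ => ?_
  rw [predictable_choice (meanReward ε best.1) π t (extendZero fun t : Fin T => z t) z
    fun i hi => by simp [extendZero, hi.trans t.2]]
  rw [reward_eq_meanReward, reward_eq_meanReward, played_eq_choice, meanReward, meanReward]
  have : ∑ i ∈ best.1, (if i ∈ best.1 then (1 : ℝ) else 0) = K := by
    rw [Finset.sum_ite_mem]
    simp [best.2]
  rw [this]
  ring

variable {Ω : Type*} [MeasurableSpace Ω] {P : Measure Ω}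
  {Z : ℕ → Ω → ℝ} {T : ℕ} {v : ℝ≥0}

lemma hasLaw_noise [IsProbabilityMeasure P] (hlaw : ∀ t < T, HasLaw (Z t) (gaussianReal 0 v) P)
    (hindep : iIndepFun (fun t : Fin T => Z t) P) :
    HasLaw (fun ω (t : Fin T) => Z t ω) (noiseLaw v T) P := by
  have hm : ∀ t : Fin T, AEMeasurable (Z t) P := fun t => (hlaw t t.2).aemeasurable
  refine ⟨aemeasurable_pi_lambda _ hm, ?_⟩
  rw [hindep.map_fun_eq_pi_map hm, noiseLaw]
  congr with t : 1
  exact (hlaw t t.2).map_eq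

lemma integrable_realizedRegret
    (hZ : HasLaw (fun ω (t : Fin T) => Z t ω) (noiseLaw v T) P) :
    Integrable (fun ω => realizedRegret ε best π T fun t => Z t ω) P := by
  simp only [realizedRegret_eq]
  have h := integrable_total v T ε π best.1
    fun a : Action N K => ε * (K - ∑ i ∈ best.1, if i ∈ a.1 then 1 else 0)
  rw [← hZ.map_eq] at h
  exact h.comp_aemeasurable hZ.aemeasurable

lemma expectedRegret_eq
    (hZ : HasLaw (fun ω (t : Fin T) => Z t ω) (noiseLaw v T) P) :
    expectedRegret ε best P Z π T
      = ε * (K * T - ∑ i ∈ best.1, expectedCount v T ε π best.1 i) := by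
  have h : expectedRegret ε best P Z π T = expectedTotal v T ε π best.1
      fun a => ε * (K + (-1) * ∑ i ∈ best.1, if i ∈ a.1 then 1 else 0) := by
    have hmap := integral_map hZ.aemeasurable (measurable_total T ε π best.1 fun a : Action N K =>
      ε * (K + (-1) * ∑ i ∈ best.1, if i ∈ a.1 then 1 else 0)).aestronglyMeasurable
    rw [hZ.map_eq] at hmap
    refine (integral_congr_ae (.of_forall fun ω => ?_)).trans hmap.symm
    simp only [realizedRegret_eq, neg_one_mul, sub_eq_add_neg]
  rw [h, expectedTotal_const_mul, expectedTotal_add, expectedTotal_const, expectedTotal_const_mul,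
    expectedTotal_sum]
  simp only [expectedCount]
  ring

end Regret

end TopKBandit

open TopKBandit in
theorem theorem1 (N K T : ℕ) (hK : 1 ≤ K) (hN : 2 * K < N) (hT : 1 ≤ T)
    (σ ε : ℝ) (hσ : 0 < σ) (hε : ε = σ / 2 * √((N : ℝ) * K / (2 * T)))
    {Ω : Type*} [MeasurableSpace Ω] (P : Measure Ω) [IsProbabilityMeasure P]
    (Z : ℕ → Ω → ℝ)
    (hlaw : ∀ t < T, HasLaw (Z t) (gaussianReal 0 (σ ^ 2).toNNReal) P)
    (hindep : iIndepFun (fun t : Fin T => Z t) P)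
    (π : Player N K) :
    -- the regret has a well-defined expectation in each environment
    (∀ best : Action N K,
      Integrable (fun ω => realizedRegret ε best π T (fun t => Z t ω)) P) ∧
    -- lower bound for a uniformly random best subset
    σ * K / 8 * √((N : ℝ) * K * T / 2) ≤
      (1 / (N.choose K : ℝ)) * ∑ best : Action N K, expectedRegret ε best P Z π T ∧
    -- lower bound for some fixed best subset
    ∃ best : Action N K,
      σ * K / 8 * √((N : ℝ) * K * T / 2) ≤ expectedRegret ε best P Z π T := by
  set v : NNReal := (σ ^ 2).toNNReal with hvdef
  have hvσ : (v : ℝ) = σ ^ 2 := Real.coe_toNNReal _ (by positivity)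
  have hv : v ≠ 0 := fun h => by
    rw [h] at hvσ
    have : 0 < σ ^ 2 := by positivity
    simp [← hvσ] at this
  have hT' : (0 : ℝ) < T := by exact_mod_cast hT
  have hK' : (0 : ℝ) < K := by exact_mod_cast hK
  have hN' : (0 : ℝ) < N := by exact_mod_cast (by omega : 0 < N)
  have hε0 : 0 ≤ ε := by rw [hε]; positivity
  have hεsq : ε ^ 2 * (8 * T) = v * (N * K) := by
    rw [hε, mul_pow, Real.sq_sqrt (by positivity), hvσ]
    field_simp
    ring
  have hεT : ε * T = σ / 2 * √((N : ℝ) * K * T / 2) := by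
    have : (N : ℝ) * K * T / 2 = (N * K / (2 * T)) * T ^ 2 := by field_simp
    rw [this, Real.sqrt_mul (by positivity), Real.sqrt_sq hT'.le, hε]
    ring
  have hZ := hasLaw_noise hlaw hindep
  have hcount := sum_expectedCount_best_le hv hK hN hT hεsq π
  have hsub : ∀ f : Finset (Fin N) → ℝ, ∑ best : Action N K, f best.1
      = ∑ a ∈ Finset.powersetCard K Finset.univ, f a := fun f =>
    (Finset.sum_subtype (p := fun a : Finset (Fin N) => a.card = K) _
      (fun a => Finset.mem_powersetCard_univ) f).symm
  have hcard : (Fintype.card (Action N K) : ℝ) = N.choose K := by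
    have := hsub fun _ => 1
    simpa using this
  have hchoose : (0 : ℝ) < N.choose K := by exact_mod_cast Nat.choose_pos (by omega : K ≤ N)
  have hsum : N.choose K * (σ * K / 8 * √((N : ℝ) * K * T / 2))
      ≤ ∑ best : Action N K, expectedRegret ε best P Z π T := by
    simp only [fun best => expectedRegret_eq ε best π hZ]
    rw [hsub fun a => ε * (K * T - ∑ i ∈ a, expectedCount v T ε π a i), ← Finset.mul_sum,
      Finset.sum_sub_distrib, Finset.sum_const, Finset.card_powersetCard, Finset.card_univ,
      Fintype.card_fin, nsmul_eq_mul]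
    -- The factor `1/4` is what the bound `3/4` on the fraction of good plays leaves.
    calc _ = ε * (1 / 4 * (K * T) * N.choose K) := by
          linear_combination (-(N.choose K : ℝ) * K / 4) * hεT
      _ ≤ _ := by
          refine mul_le_mul_of_nonneg_left ?_ hε0
          linarith
  refine ⟨fun best => integrable_realizedRegret ε best π hZ, ?_, ?_⟩
  · rw [one_div, inv_mul_eq_div, le_div_iff₀ hchoose, mul_comm]
    exact hsum
  · by_contra! hlt
    have hne : Nonempty (Action N K) := by
      rw [← Fintype.card_pos_iff]
      exact_mod_cast hcard ▸ hchoose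
    have := Finset.sum_lt_sum_of_nonempty Finset.univ_nonempty
      fun (best : Action N K) _ => hlt best
    rw [Finset.sum_const, Finset.card_univ, nsmul_eq_mul, hcard] at this
    linarith
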